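/- Operads are taken in the species formalism (positive, i.e. without nullary operations, with symmetric group actions, a unit and partial compositions $\circ_a:\mathcal P_A\otimes\mathcal P_B\to\mathcal P_{(A\setminus\{a\})\sqcup B}$); an operad morphism is called surjective if it is surjective on every component. Let $\mathcal M$ be the magmatic set operad, i.e. the free set operad on one binary operation $\mu$ (without symmetry), written $xy$. Let $\mathbf{As}$, $\mathbf{TAs}$ and $\mathbf{NAPNAP}'$ be the quotients of $\mathcal M$ by the operadic equivalence relations generated respectively by $x(yz)=(xy)z$; by $x(yz)=(yx)z$; and by the two relations $x(yz)=y(xz)$, $(xy)z=(yx)z$. Let $\mathbf{Perm}$ be the set operad with $\mathbf{Perm}_A=A$ and, for $a,a'\in A$, $b'\in B$, $a'\circ_a b'=b'$ if $a=a'$ and $a'\circ_a b'=a'$ if $a\ne a'$; its binary generator (corresponding to the product in $x(yz)=(xy)z=y(xz)=(yx)z$) is the element $2\in\mathbf{Perm}_{\{1,2\}}$. Let $\mathbf k$ be a field, and let $\Omega$ be a set-theoretical Perm algebra, i.e. a set with a binary product such that $\alpha(\beta\gamma)=(\alpha\beta)\gamma=\beta(\alpha\gamma)=(\beta\alpha)\gamma$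 for all $\alpha,\beta,\gamma\in\Omega$. Let $\mathbf{As}_\Omega$, $\mathbf{TAs}_\Omega$, $\mathbf{NAPNAP}'_\Omega$ and $\mathbf{PreLie}_\Omega$ be the $\mathbf k$-linear operads generated by binary operations $\rhd_{\alpha,\beta}$ ($\alpha,\beta\in\Omega$, without symmetry) subject, for all $\alpha,\beta,\gamma\in\Omega$, respectively to the following relations. * $\mathbf{As}_\Omega$: $x\rhd_{\alpha,\beta\gamma}(y\rhd_{\beta,\gamma}z)=(x\rhd_{\alpha,\beta}y)\rhd_{\alpha\beta,\gamma}z$. * $\mathbf{TAs}_\Omega$: $x\rhd_{\alpha,\beta\gamma}(y\rhd_{\beta,\gamma}z)=-(y\rhd_{\beta,\alpha}x)\rhd_{\beta\alpha,\gamma}z$. * $\mathbf{NAPNAP}'_\Omega$: $x\rhd_{\alpha,\beta\gamma}(y\rhd_{\beta,\gamma}z)=y\rhd_{\beta,\alpha\gamma}(x\rhd_{\alpha,\gamma}z)$ and $(x\rhd_{\alpha,\beta}y)\rhd_{\alpha\beta,\gamma}z=(y\rhd_{\beta,\alpha}x)\rhd_{\beta\alpha,\gamma}z$. * $\mathbf{PreLie}_\Omega$: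 $x\rhd_{\alpha,\beta\gamma}(y\rhd_{\beta,\gamma}z)-(x\rhd_{\alpha,\beta}y)\rhd_{\alpha\beta,\gamma}z=y\rhd_{\beta,\alpha\gamma}(x\rhd_{\alpha,\gamma}z)-(y\rhd_{\beta,\alpha}x)\rhd_{\beta\alpha,\gamma}z$. Then: 1. There are surjective morphisms of set operads $\mathbf{As}\to\mathbf{Perm}$, $\mathbf{TAs}\to\mathbf{Perm}$ and $\mathbf{NAPNAP}'\to\mathbf{Perm}$, each sending the binary generator to the binary generator. 2. There are surjective morphisms of $\mathbf k$-linear operads $\mathbf{PreLie}_\Omega\to\mathbf{As}_\Omega$, $\mathbf{PreLie}_\Omega\to\mathbf{TAs}_\Omega$ and $\mathbf{PreLie}_\Omega\to\mathbf{NAPNAP}'_\Omega$, each sending $\rhd_{\alpha,\beta}$ to $\rhd_{\alpha,\beta}$ for all $\alpha,\beta\in\Omega$. -/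

import Mathlib

namespace SpeciesOperad

universe u v w

/-! ### Index sets of partial compositions -/

/-- The index set `A ⊔_a B = (A \ {a}) ⊔ B`. -/
abbrev Ins (A : Type) (a : A) (B : Type) : Type := {x : A // x ≠ a} ⊕ B

namespace Ins

/-- The bijection `A ⊔_a B ≃ A' ⊔_{e a} B'` induced by bijections `e : A ≃ A'`, `f : B ≃ B'`. -/
def congr {A A' B B' : Type} (e : A ≃ A') (a : A) (f : B ≃ B') : Ins A a B ≃ Ins A' (e a) B' :=
  Equiv.sumCongr (e.subtypeEquiv fun x => by simp) f

/-- The identification `A ⊔_a (B ⊔_b C) = (A ⊔_a B) ⊔_b C` for `b ∈ B`. -/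
def seq {A B C : Type} (a : A) (b : B) :
    Ins A a (Ins B b C) ≃ Ins (Ins A a B) (Sum.inr b) C where
  toFun
    | Sum.inl x => Sum.inl ⟨Sum.inl x, by simp⟩
    | Sum.inr (Sum.inl y) => Sum.inl ⟨Sum.inr y.1, by simpa using y.2⟩
    | Sum.inr (Sum.inr c) => Sum.inr c
  invFun
    | Sum.inl ⟨Sum.inl x, _⟩ => Sum.inl x
    | Sum.inl ⟨Sum.inr y, h⟩ => Sum.inr (Sum.inl ⟨y, by simpa using h⟩)
    | Sum.inr c => Sum.inr (Sum.inr c)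
  left_inv := by rintro (x | y | c) <;> rfl
  right_inv := by rintro (⟨x | y, h⟩ | c) <;> rfl

/-- The identification `(A ⊔_{a'} C) ⊔_a B = (A ⊔_a B) ⊔_{a'} C` for distinct `a, a' ∈ A`. -/
def par {A B C : Type} {a a' : A} (h : a ≠ a') :
    Ins (Ins A a' C) (Sum.inl ⟨a, h⟩) B ≃ Ins (Ins A a B) (Sum.inl ⟨a', h.symm⟩) C where
  toFun
    | Sum.inl ⟨Sum.inl x, hx⟩ =>
        Sum.inl ⟨Sum.inl ⟨x.1, fun e => hx (by simp [← e])⟩,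
          fun e => x.2 (congrArg Subtype.val (Sum.inl.inj e))⟩
    | Sum.inl ⟨Sum.inr c, _⟩ => Sum.inr c
    | Sum.inr b => Sum.inl ⟨Sum.inr b, by simp⟩
  invFun
    | Sum.inl ⟨Sum.inl x, hx⟩ =>
        Sum.inl ⟨Sum.inl ⟨x.1, fun e => hx (by simp [← e])⟩,
          fun e => x.2 (congrArg Subtype.val (Sum.inl.inj e))⟩
    | Sum.inl ⟨Sum.inr b, _⟩ => Sum.inr b
    | Sum.inr c => Sum.inl ⟨Sum.inr c, by simp⟩
  left_inv := by rintro (⟨x | y, h⟩ | c) <;> rfl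
  right_inv := by rintro (⟨x | y, h⟩ | c) <;> rfl

/-- The identification `A = A ⊔_a {*}`, sending `a` to `*`. -/
noncomputable def unitRight {A : Type} (a : A) : A ≃ Ins A a Unit where
  toFun x := open Classical in if h : x = a then Sum.inr () else Sum.inl ⟨x, h⟩
  invFun := Sum.elim Subtype.val fun _ => a
  left_inv x := by by_cases h : x = a <;> simp [h]
  right_inv := by
    rintro (x | u)
    · simp [x.2]
    · simp

/-- The identification `B = {*} ⊔_* B`. -/
def unitLeft (B : Type) : B ≃ Ins Unit () B where
  toFun := Sum.inr
  invFun := Sum.elim (fun x => absurd rfl x.2) id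
  left_inv _ := rfl
  right_inv := by
    rintro (x | b)
    · exact absurd rfl x.2
    · rfl

end Ins

/-! ### Set operads -/

/-- A set operad in the species formalism: a positive set species (functorial for bijections of
finite sets, here covariantly: a bijection acts by its inverse in the contravariant convention) with a unit and partial compositions `∘_a : P_A × P_B → P_{A ⊔_a B}` that are
functorial, unital, and satisfy the sequential and parallel associativity axioms. -/
structure SetOperad where
  obj : (A : Type) → [Finite A] → Type u
  relabel : {A B : Type} → [Finite A] → [Finite B] → A ≃ B → obj A → obj B
  one : obj Unit
  comp : {A B : Type} → [Finite A] → [Finite B] → (a : A) → obj A → obj B → obj (Ins A a B)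
  positive : ∀ (A : Type) [Finite A] [IsEmpty A], IsEmpty (obj A)
  relabel_refl : ∀ {A : Type} [Finite A] (p : obj A), relabel (Equiv.refl A) p = p
  relabel_trans : ∀ {A B C : Type} [Finite A] [Finite B] [Finite C] (e : A ≃ B) (f : B ≃ C)
    (p : obj A), relabel (e.trans f) p = relabel f (relabel e p)
  comp_relabel : ∀ {A A' B B' : Type} [Finite A] [Finite A'] [Finite B] [Finite B']
    (e : A ≃ A') (f : B ≃ B') (a : A) (p : obj A) (q : obj B),
    comp (e a) (relabel e p) (relabel f q) = relabel (Ins.congr e a f) (comp a p q)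
  comp_seq : ∀ {A B C : Type} [Finite A] [Finite B] [Finite C] (a : A) (b : B)
    (p : obj A) (q : obj B) (r : obj C),
    comp (Sum.inr b) (comp a p q) r = relabel (Ins.seq a b) (comp a p (comp b q r))
  comp_par : ∀ {A B C : Type} [Finite A] [Finite B] [Finite C] {a a' : A} (h : a ≠ a')
    (p : obj A) (q : obj B) (r : obj C),
    comp (Sum.inl ⟨a', h.symm⟩) (comp a p q) r =
      relabel (Ins.par h) (comp (Sum.inl ⟨a, h⟩) (comp a' p r) q)
  comp_one : ∀ {A : Type} [Finite A] (a : A) (p : obj A),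
    comp a p one = relabel (Ins.unitRight a) p
  one_comp : ∀ {B : Type} [Finite B] (q : obj B),
    comp () one q = relabel (Ins.unitLeft B) q

namespace SetOperad

/-- Morphisms of set operads. -/
structure Hom (P : SetOperad.{u}) (Q : SetOperad.{v}) where
  app : {A : Type} → [Finite A] → P.obj A → Q.obj A
  app_relabel : ∀ {A B : Type} [Finite A] [Finite B] (e : A ≃ B) (p : P.obj A),
    app (P.relabel e p) = Q.relabel e (app p)
  app_one : app P.one = Q.one
  app_comp : ∀ {A B : Type} [Finite A] [Finite B] (a : A) (p : P.obj A) (q : P.obj B),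
    app (P.comp a p q) = Q.comp a (app p) (app q)

/-- A morphism of set operads is surjective if all its components are. -/
def Hom.Surjective {P : SetOperad.{u}} {Q : SetOperad.{v}} (f : Hom P Q) : Prop :=
  ∀ (A : Type) [Finite A], Function.Surjective (f.app (A := A))

/-- The finest equivalence relation on `P` that is compatible with the operad structure and
contains the relation `R` (given on the component of `P` at `X`). -/
inductive Cong (P : SetOperad.{u}) {X : Type} [Finite X] (R : P.obj X → P.obj X → Prop) :
    (A : Type) → [Finite A] → P.obj A → P.obj A → Prop
  | of {p q : P.obj X} : R p q → Cong P R X p q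
  | refl {A : Type} [Finite A] (p : P.obj A) : Cong P R A p p
  | symm {A : Type} [Finite A] {p q : P.obj A} : Cong P R A p q → Cong P R A q p
  | trans {A : Type} [Finite A] {p q r : P.obj A} :
      Cong P R A p q → Cong P R A q r → Cong P R A p r
  | relabel {A B : Type} [Finite A] [Finite B] (e : A ≃ B) {p q : P.obj A} :
      Cong P R A p q → Cong P R B (P.relabel e p) (P.relabel e q)
  | comp {A B : Type} [Finite A] [Finite B] (a : A) {p p' : P.obj A} {q q' : P.obj B} :
      Cong P R A p p' → Cong P R B q q' → Cong P R (Ins A a B) (P.comp a p q) (P.comp a p' q')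

/-- The congruence generated by `R`, as a family of setoids. -/
def congSetoid (P : SetOperad.{u}) {X : Type} [Finite X] (R : P.obj X → P.obj X → Prop)
    (A : Type) [Finite A] : Setoid (P.obj A) :=
  ⟨Cong P R A, Cong.refl, Cong.symm, Cong.trans⟩

/-- The quotient of a set operad by the operadic congruence generated by `R`. -/
def quotient (P : SetOperad.{u}) {X : Type} [Finite X] (R : P.obj X → P.obj X → Prop) :
    SetOperad.{u} where
  obj A _ := Quotient (P.congSetoid R A)
  relabel e := Quotient.map (P.relabel e) fun _ _ h => Cong.relabel e h
  one := Quotient.mk _ P.one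
  comp a := Quotient.map₂ (P.comp a) fun _ _ h _ _ h' => Cong.comp a h h'
  positive A _ _ := ⟨fun x => Quotient.inductionOn x fun p => (P.positive A).false p⟩
  relabel_refl := by
    rintro A _ ⟨p⟩
    exact congrArg (Quotient.mk _) (P.relabel_refl p)
  relabel_trans := by
    rintro A B C _ _ _ e f ⟨p⟩
    exact congrArg (Quotient.mk _) (P.relabel_trans e f p)
  comp_relabel := by
    rintro A A' B B' _ _ _ _ e f a ⟨p⟩ ⟨q⟩
    exact congrArg (Quotient.mk _) (P.comp_relabel e f a p q)
  comp_seq := by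
    rintro A B C _ _ _ a b ⟨p⟩ ⟨q⟩ ⟨r⟩
    exact congrArg (Quotient.mk _) (P.comp_seq a b p q r)
  comp_par := by
    rintro A B C _ _ _ a a' h ⟨p⟩ ⟨q⟩ ⟨r⟩
    exact congrArg (Quotient.mk _) (P.comp_par h p q r)
  comp_one := by
    rintro A _ a ⟨p⟩
    exact congrArg (Quotient.mk _) (P.comp_one a p)
  one_comp := by
    rintro B _ ⟨q⟩
    exact congrArg (Quotient.mk _) (P.one_comp q)

/-- The class of an operation in the quotient operad. -/
def quotientMk (P : SetOperad.{u}) {X : Type} [Finite X] (R : P.obj X → P.obj X → Prop)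
    {A : Type} [Finite A] (p : P.obj A) : (P.quotient R).obj A :=
  Quotient.mk (P.congSetoid R A) p

end SetOperad

/-! ### The free operad on a set of binary generators -/

/-- Planar binary trees with internal vertices decorated by `G` and leaves decorated by `A`,
i.e. formal expressions in the variables `A` and the binary operations `G`. -/
inductive Tree (G : Type u) (A : Type) : Type u
  | leaf : A → Tree G A
  | node : G → Tree G A → Tree G A → Tree G A

namespace Tree

variable {G : Type u} {A B C : Type}

/-- The list of leaf decorations, from left to right. -/
def leaves : Tree G A → List A
  | leaf a => [a]
  | node _ l r => l.leaves ++ r.leaves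

/-- Substitution of trees for the leaves. -/
def bind : Tree G A → (A → Tree G B) → Tree G B
  | leaf a, f => f a
  | node g l r, f => node g (l.bind f) (r.bind f)

/-- Renaming of the leaves. -/
def map (f : A → B) (t : Tree G A) : Tree G B := t.bind fun a => leaf (f a)

theorem bind_assoc (t : Tree G A) (f : A → Tree G B) (g : B → Tree G C) :
    (t.bind f).bind g = t.bind fun a => (f a).bind g := by
  induction t with
  | leaf a => rfl
  | node x l r hl hr => simp [bind, hl, hr]

theorem bind_leaf (t : Tree G A) : t.bind leaf = t := by
  induction t with
  | leaf a => rfl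
  | node x l r hl hr => simp [bind, hl, hr]

theorem leaves_bind (t : Tree G A) (f : A → Tree G B) :
    (t.bind f).leaves = t.leaves.flatMap fun a => (f a).leaves := by
  induction t with
  | leaf a => simp [bind, leaves]
  | node x l r hl hr => simp [bind, leaves, hl, hr]

theorem leaves_map (t : Tree G A) (f : A → B) : (t.map f).leaves = t.leaves.map f := by
  rw [map, leaves_bind]
  induction t.leaves with
  | nil => rfl
  | cons a l h => rw [List.flatMap_cons, h]; rfl

theorem leaves_ne_nil (t : Tree G A) : t.leaves ≠ [] := by
  induction t with
  | leaf a => simp [leaves]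
  | node x l r hl hr => simp [leaves, hl]

/-- Every variable of `A` occurs exactly once. -/
def Multilinear (t : Tree G A) : Prop := t.leaves.Nodup ∧ ∀ a, a ∈ t.leaves

theorem Multilinear.map {t : Tree G A} (ht : t.Multilinear) (e : A ≃ B) :
    (t.map e).Multilinear := by
  constructor
  · rw [leaves_map]
    exact ht.1.map e.injective
  · intro b
    rw [leaves_map, List.mem_map]
    exact ⟨e.symm b, ht.2 _, by simp⟩

/-- What replaces the leaf `x` in the grafting of `q` on the leaf `a`. -/
noncomputable def graftAt (a : A) (q : Tree G B) (x : A) : Tree G (Ins A a B) :=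
  open Classical in if h : x = a then q.map Sum.inr else leaf (Sum.inl ⟨x, h⟩)

/-- The grafting of `q` on the leaf `a` of `p`. -/
noncomputable def graft (a : A) (p : Tree G A) (q : Tree G B) : Tree G (Ins A a B) :=
  p.bind (graftAt a q)

theorem graftAt_self (a : A) (q : Tree G B) : graftAt a q a = q.map Sum.inr := by
  simp [graftAt]

theorem graftAt_ne {a : A} (q : Tree G B) {x : A} (h : x ≠ a) :
    graftAt a q x = leaf (Sum.inl ⟨x, h⟩) := by
  simp [graftAt, h]

theorem mem_leaves_graftAt {a : A} {q : Tree G B} {x : A} {y : Ins A a B}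
    (hy : y ∈ (graftAt a q x).leaves) : Sum.elim Subtype.val (fun _ => a) y = x := by
  by_cases h : x = a
  · subst h
    rw [graftAt_self, leaves_map, List.mem_map] at hy
    obtain ⟨b, -, rfl⟩ := hy
    rfl
  · rw [graftAt_ne q h] at hy
    simp only [leaves, List.mem_singleton] at hy
    subst hy
    rfl

theorem Multilinear.graft {a : A} {p : Tree G A} {q : Tree G B} (hp : p.Multilinear)
    (hq : q.Multilinear) : (graft a p q).Multilinear := by
  constructor
  · rw [Tree.graft, leaves_bind, List.nodup_flatMap]
    refine ⟨fun x _ => ?_, hp.1.imp fun {x y} hxy => ?_⟩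
    · by_cases h : x = a
      · subst h
        rw [graftAt_self, leaves_map]
        exact hq.1.map Sum.inr_injective
      · rw [graftAt_ne q h]
        simp [leaves]
    · intro z hz hz'
      exact hxy ((mem_leaves_graftAt hz).symm.trans (mem_leaves_graftAt hz'))
  · intro y
    rw [Tree.graft, leaves_bind, List.mem_flatMap]
    rcases y with x | b
    · exact ⟨x.1, hp.2 _, by rw [graftAt_ne q x.2]; simp [leaves]⟩
    · refine ⟨a, hp.2 _, ?_⟩
      rw [graftAt_self, leaves_map, List.mem_map]
      exact ⟨b, hq.2 _, rfl⟩

theorem graft_map {A' B' : Type} (e : A ≃ A') (f : B ≃ B') (a : A) (p : Tree G A) (q : Tree G B) :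
    graft (e a) (p.map e) (q.map f) = (graft a p q).map (Ins.congr e a f) := by
  simp only [graft, map, bind_assoc, bind]
  congr 1
  funext x
  by_cases h : x = a
  · subst h
    simp [graftAt_self, map, bind_assoc, bind, Ins.congr]
  · rw [graftAt_ne q h, graftAt_ne _ (by simpa using h)]
    simp [bind, Ins.congr]

theorem graft_seq (a : A) (b : B) (p : Tree G A) (q : Tree G B) (r : Tree G C) :
    graft (Sum.inr b) (graft a p q) r = (graft a p (graft b q r)).map (Ins.seq a b) := by
  simp only [graft, map, bind_assoc]
  congr 1
  funext x
  by_cases h : x = a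
  · subst h
    simp only [graftAt_self, map, bind_assoc, bind]
    congr 1
    funext y
    by_cases h' : y = b
    · subst h'
      simp [graftAt_self, map, bind_assoc, bind, Ins.seq]
    · rw [graftAt_ne r h', graftAt_ne _ (by simpa using h')]
      simp [bind, Ins.seq]
  · rw [graftAt_ne _ h, graftAt_ne _ h]
    simp only [bind]
    rw [graftAt_ne _ (by simp)]
    simp [Ins.seq]

theorem graft_par {a a' : A} (h : a ≠ a') (p : Tree G A) (q : Tree G B) (r : Tree G C) :
    graft (Sum.inl ⟨a', h.symm⟩) (graft a p q) r =
      (graft (Sum.inl ⟨a, h⟩) (graft a' p r) q).map (Ins.par h) := by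
  simp only [graft, map, bind_assoc]
  congr 1
  funext x
  by_cases h1 : x = a
  · subst h1
    rw [graftAt_self, graftAt_ne _ h]
    simp only [map, bind_assoc, bind, graftAt_self]
    congr 1
    funext y
    rw [graftAt_ne _ (by simp)]
    simp [Ins.par]
  · by_cases h2 : x = a'
    · subst h2
      rw [graftAt_self, graftAt_ne _ h1]
      simp only [map, bind_assoc, bind, graftAt_self]
      congr 1
      funext y
      rw [graftAt_ne _ (by simp)]
      simp [Ins.par, bind]
    · rw [graftAt_ne _ h1, graftAt_ne _ h2]
      simp only [bind]
      rw [graftAt_ne _ (by simpa using h2), graftAt_ne _ (by simpa using h1)]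
      simp [Ins.par, bind]

theorem graft_unit (a : A) (p : Tree G A) :
    graft a p (leaf ()) = p.map (Ins.unitRight a) := by
  simp only [graft, map]
  congr 1
  funext x
  by_cases h : x = a
  · subst h
    simp [graftAt_self, map, bind, Ins.unitRight]
  · rw [graftAt_ne _ h]
    simp [Ins.unitRight, h]

end Tree

/-- The free set operad `M_G` generated by binary operations indexed by `G`, without any symmetry:
its component at `A` consists of the trees whose leaves are in bijection with `A`. -/
noncomputable def freeOperad (G : Type u) : SetOperad.{u} where
  obj A _ := {t : Tree G A // t.Multilinear}
  relabel e p := ⟨p.1.map e, p.2.map e⟩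
  one := ⟨Tree.leaf (), by simp [Tree.Multilinear, Tree.leaves]⟩
  comp a p q := ⟨Tree.graft a p.1 q.1, p.2.graft q.2⟩
  positive A _ _ := ⟨fun t => t.1.leaves_ne_nil (by
    cases h : t.1.leaves with
    | nil => rfl
    | cons a l => exact isEmptyElim a)⟩
  relabel_refl p := Subtype.ext (Tree.bind_leaf p.1)
  relabel_trans e f p := Subtype.ext (by simp [Tree.map, Tree.bind_assoc, Tree.bind])
  comp_relabel e f a p q := Subtype.ext (Tree.graft_map e f a p.1 q.1)
  comp_seq a b p q r := Subtype.ext (Tree.graft_seq a b p.1 q.1 r.1)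
  comp_par h p q r := Subtype.ext (Tree.graft_par h p.1 q.1 r.1)
  comp_one a p := Subtype.ext (Tree.graft_unit a p.1)
  one_comp q := Subtype.ext (by
    simp [Tree.graft, Tree.bind, Tree.graftAt_self, Ins.unitLeft])

section Trees

variable {G : Type u}

/-- The generator `g`, as the operation `x₀ ·_g x₁`. -/
def gen (g : G) : (freeOperad G).obj (Fin 2) :=
  ⟨.node g (.leaf 0) (.leaf 1), by simp only [Tree.Multilinear, Tree.leaves]; decide⟩

/-- The operation `x ·_g (y ·_h z)`, where `x, y, z` are the three variables in some order. -/
def rightTree (g h : G) (x y z : Fin 3)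
    (H : [x, y, z].Nodup ∧ ∀ a, a ∈ [x, y, z] := by decide) : (freeOperad G).obj (Fin 3) :=
  ⟨.node g (.leaf x) (.node h (.leaf y) (.leaf z)), H⟩

/-- The operation `(x ·_h y) ·_g z`, where `x, y, z` are the three variables in some order. -/
def leftTree (h g : G) (x y z : Fin 3)
    (H : [x, y, z].Nodup ∧ ∀ a, a ∈ [x, y, z] := by decide) : (freeOperad G).obj (Fin 3) :=
  ⟨.node g (.node h (.leaf x) (.leaf y)) (.leaf z), H⟩

end Trees

/-! ### The set operads `As`, `TAs`, `NAPNAP'` and `Perm` -/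

/-- The magmatic operad. -/
noncomputable abbrev magmatic : SetOperad.{0} := freeOperad Unit

/-- `x(yz) = (xy)z`. -/
inductive AsRel : magmatic.obj (Fin 3) → magmatic.obj (Fin 3) → Prop
  | assoc : AsRel (rightTree () () 0 1 2) (leftTree () () 0 1 2)

/-- `x(yz) = (yx)z`. -/
inductive TAsRel : magmatic.obj (Fin 3) → magmatic.obj (Fin 3) → Prop
  | twist : TAsRel (rightTree () () 0 1 2) (leftTree () () 1 0 2)

/-- `x(yz) = y(xz)` and `(xy)z = (yx)z`. -/
inductive NAPNAPRel : magmatic.obj (Fin 3) → magmatic.obj (Fin 3) → Prop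
  | nap : NAPNAPRel (rightTree () () 0 1 2) (rightTree () () 1 0 2)
  | nap' : NAPNAPRel (leftTree () () 0 1 2) (leftTree () () 1 0 2)

/-- The associative set operad. -/
noncomputable def As : SetOperad.{0} := magmatic.quotient AsRel

/-- The twist-associative set operad. -/
noncomputable def TAs : SetOperad.{0} := magmatic.quotient TAsRel

/-- The `NAPNAP'` set operad. -/
noncomputable def NAPNAP : SetOperad.{0} := magmatic.quotient NAPNAPRel

/-- The binary generator of `As`. -/
noncomputable def As.mu : As.obj (Fin 2) := magmatic.quotientMk AsRel (gen ())

/-- The binary generator of `TAs`. -/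
noncomputable def TAs.mu : TAs.obj (Fin 2) := magmatic.quotientMk TAsRel (gen ())

/-- The binary generator of `NAPNAP'`. -/
noncomputable def NAPNAP.mu : NAPNAP.obj (Fin 2) := magmatic.quotientMk NAPNAPRel (gen ())

/-- The operad `Perm`: `Perm_A = A`, and `a' ∘_a b'` is `b'` if `a' = a` and `a'` otherwise. -/
noncomputable def Perm : SetOperad.{0} where
  obj A _ := A
  relabel e := e
  one := ()
  comp a a' b' := open Classical in if h : a' = a then Sum.inr b' else Sum.inl ⟨a', h⟩
  positive _ _ h := h
  relabel_refl _ := rfl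
  relabel_trans _ _ _ := rfl
  comp_relabel e f a p q := by
    by_cases h : p = a <;> simp [h, Ins.congr]
  comp_seq a b p q r := by
    by_cases h : p = a
    · by_cases h' : q = b <;> simp [h, h', Ins.seq]
    · simp [h, Ins.seq]
  comp_par {A B C _ _ _ a a'} h p q r := by
    by_cases h1 : p = a
    · subst h1
      simp [h, Ins.par]
    · by_cases h2 : p = a'
      · subst h2
        simp [h1, Ins.par]
      · simp [h1, h2, Ins.par]
  comp_one _ _ := rfl
  one_comp _ := by simp [Ins.unitLeft]

/-- The binary generator of `Perm`, satisfying `x(yz) = (xy)z = y(xz) = (yx)z`. -/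
noncomputable def Perm.mu : Perm.obj (Fin 2) := (1 : Fin 2)

/-! ### Linear operads -/

/-- A linear operad over `k` in the species formalism. -/
structure LinOperad (k : Type v) [Field k] where
  obj : (A : Type) → [Finite A] → Type w
  [addCommGroup : (A : Type) → [Finite A] → AddCommGroup (obj A)]
  [module : (A : Type) → [Finite A] → Module k (obj A)]
  relabel : {A B : Type} → [Finite A] → [Finite B] → A ≃ B → obj A →ₗ[k] obj B
  one : obj Unit
  comp : {A B : Type} → [Finite A] → [Finite B] → (a : A) →
    obj A →ₗ[k] obj B →ₗ[k] obj (Ins A a B)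
  positive : ∀ (A : Type) [Finite A] [IsEmpty A], Subsingleton (obj A)
  relabel_refl : ∀ {A : Type} [Finite A] (p : obj A), relabel (Equiv.refl A) p = p
  relabel_trans : ∀ {A B C : Type} [Finite A] [Finite B] [Finite C] (e : A ≃ B) (f : B ≃ C)
    (p : obj A), relabel (e.trans f) p = relabel f (relabel e p)
  comp_relabel : ∀ {A A' B B' : Type} [Finite A] [Finite A'] [Finite B] [Finite B']
    (e : A ≃ A') (f : B ≃ B') (a : A) (p : obj A) (q : obj B),
    comp (e a) (relabel e p) (relabel f q) = relabel (Ins.congr e a f) (comp a p q)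
  comp_seq : ∀ {A B C : Type} [Finite A] [Finite B] [Finite C] (a : A) (b : B)
    (p : obj A) (q : obj B) (r : obj C),
    comp (Sum.inr b) (comp a p q) r = relabel (Ins.seq a b) (comp a p (comp b q r))
  comp_par : ∀ {A B C : Type} [Finite A] [Finite B] [Finite C] {a a' : A} (h : a ≠ a')
    (p : obj A) (q : obj B) (r : obj C),
    comp (Sum.inl ⟨a', h.symm⟩) (comp a p q) r =
      relabel (Ins.par h) (comp (Sum.inl ⟨a, h⟩) (comp a' p r) q)
  comp_one : ∀ {A : Type} [Finite A] (a : A) (p : obj A),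
    comp a p one = relabel (Ins.unitRight a) p
  one_comp : ∀ {B : Type} [Finite B] (q : obj B),
    comp () one q = relabel (Ins.unitLeft B) q

attribute [instance] LinOperad.addCommGroup LinOperad.module

namespace LinOperad

variable {k : Type v} [Field k]

/-- Morphisms of linear operads. -/
structure Hom (P Q : LinOperad.{v, w} k) where
  app : {A : Type} → [Finite A] → P.obj A →ₗ[k] Q.obj A
  app_relabel : ∀ {A B : Type} [Finite A] [Finite B] (e : A ≃ B) (p : P.obj A),
    app (P.relabel e p) = Q.relabel e (app p)
  app_one : app P.one = Q.one
  app_comp : ∀ {A B : Type} [Finite A] [Finite B] (a : A) (p : P.obj A) (q : P.obj B),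
    app (P.comp a p q) = Q.comp a (app p) (app q)

/-- A morphism of linear operads is surjective if all its components are. -/
def Hom.Surjective {P Q : LinOperad.{v, w} k} (f : Hom P Q) : Prop :=
  ∀ (A : Type) [Finite A], Function.Surjective (f.app (A := A))

/-- Membership in the operadic ideal generated by a set `R` of elements of the component of `P`
at `X`: the smallest family of linear subspaces that contains `R` and is stable under relabeling
and under partial compositions on both sides. -/
inductive MemIdeal (P : LinOperad.{v, w} k) {X : Type} [Finite X] (R : Set (P.obj X)) :
    (A : Type) → [Finite A] → P.obj A → Prop
  | of {p : P.obj X} : p ∈ R → MemIdeal P R X p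
  | zero {A : Type} [Finite A] : MemIdeal P R A 0
  | add {A : Type} [Finite A] {p q : P.obj A} :
      MemIdeal P R A p → MemIdeal P R A q → MemIdeal P R A (p + q)
  | smul {A : Type} [Finite A] (c : k) {p : P.obj A} : MemIdeal P R A p → MemIdeal P R A (c • p)
  | relabel {A B : Type} [Finite A] [Finite B] (e : A ≃ B) {p : P.obj A} :
      MemIdeal P R A p → MemIdeal P R B (P.relabel e p)
  | comp_left {A B : Type} [Finite A] [Finite B] (a : A) {p : P.obj A} (q : P.obj B) :
      MemIdeal P R A p → MemIdeal P R (Ins A a B) (P.comp a p q)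
  | comp_right {A B : Type} [Finite A] [Finite B] (a : A) (p : P.obj A) {q : P.obj B} :
      MemIdeal P R B q → MemIdeal P R (Ins A a B) (P.comp a p q)

/-- The operadic ideal generated by `R`. -/
def ideal (P : LinOperad.{v, w} k) {X : Type} [Finite X] (R : Set (P.obj X))
    (A : Type) [Finite A] : Submodule k (P.obj A) where
  carrier := {p | MemIdeal P R A p}
  zero_mem' := MemIdeal.zero
  add_mem' := MemIdeal.add
  smul_mem' c _ h := MemIdeal.smul c h

/-- Partial compositions in the quotient by an operadic ideal. -/
def quotientComp (P : LinOperad.{v, w} k) {X : Type} [Finite X] (R : Set (P.obj X))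
    {A B : Type} [Finite A] [Finite B] (a : A) :
    (P.obj A ⧸ P.ideal R A) →ₗ[k] (P.obj B ⧸ P.ideal R B) →ₗ[k]
      (P.obj (Ins A a B) ⧸ P.ideal R (Ins A a B)) :=
  (P.ideal R A).liftQ
    { toFun := fun p => (P.ideal R B).mapQ (P.ideal R (Ins A a B)) (P.comp a p)
        fun _ hq => MemIdeal.comp_right a p hq
      map_add' := fun p p' => by
        refine Submodule.linearMap_qext _ (LinearMap.ext fun q => ?_)
        exact congrArg Submodule.Quotient.mk (by rw [map_add, LinearMap.add_apply])
      map_smul' := fun c p => by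
        refine Submodule.linearMap_qext _ (LinearMap.ext fun q => ?_)
        exact congrArg Submodule.Quotient.mk (by rw [map_smul, LinearMap.smul_apply]; rfl) }
    fun p hp => by
      refine Submodule.linearMap_qext _ (LinearMap.ext fun q => ?_)
      exact (Submodule.Quotient.mk_eq_zero _).2 (MemIdeal.comp_left a q hp)

/-- The quotient of a linear operad by the operadic ideal generated by `R`. -/
def quotient (P : LinOperad.{v, w} k) {X : Type} [Finite X] (R : Set (P.obj X)) :
    LinOperad.{v, w} k where
  obj A _ := P.obj A ⧸ P.ideal R A
  relabel e := (P.ideal R _).mapQ (P.ideal R _) (P.relabel e) fun _ h => MemIdeal.relabel e h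
  one := Submodule.Quotient.mk P.one
  comp a := P.quotientComp R a
  positive A _ _ := by
    have := P.positive A
    exact (Submodule.Quotient.mk_surjective (P.ideal R A)).subsingleton
  relabel_refl := by
    rintro A _ ⟨p⟩
    exact congrArg Submodule.Quotient.mk (P.relabel_refl p)
  relabel_trans := by
    rintro A B C _ _ _ e f ⟨p⟩
    exact congrArg Submodule.Quotient.mk (P.relabel_trans e f p)
  comp_relabel := by
    rintro A A' B B' _ _ _ _ e f a ⟨p⟩ ⟨q⟩
    exact congrArg Submodule.Quotient.mk (P.comp_relabel e f a p q)
  comp_seq := by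
    rintro A B C _ _ _ a b ⟨p⟩ ⟨q⟩ ⟨r⟩
    exact congrArg Submodule.Quotient.mk (P.comp_seq a b p q r)
  comp_par := by
    rintro A B C _ _ _ a a' h ⟨p⟩ ⟨q⟩ ⟨r⟩
    exact congrArg Submodule.Quotient.mk (P.comp_par h p q r)
  comp_one := by
    rintro A _ a ⟨p⟩
    exact congrArg Submodule.Quotient.mk (P.comp_one a p)
  one_comp := by
    rintro B _ ⟨q⟩
    exact congrArg Submodule.Quotient.mk (P.one_comp q)

/-- The class of an operation in the quotient operad. -/
def quotientMk (P : LinOperad.{v, w} k) {X : Type} [Finite X] (R : Set (P.obj X))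
    {A : Type} [Finite A] (p : P.obj A) : (P.quotient R).obj A :=
  (P.ideal R A).mkQ p

end LinOperad

/-- Bilinear extension of the partial compositions of a set operad. -/
noncomputable def linComp (k : Type v) [Field k] (P : SetOperad.{u}) {A B : Type} [Finite A]
    [Finite B] (a : A) :
    (P.obj A →₀ k) →ₗ[k] (P.obj B →₀ k) →ₗ[k] (P.obj (Ins A a B) →₀ k) :=
  Finsupp.lift _ k _ fun p => Finsupp.lmapDomain k k (P.comp a p)

theorem linComp_single (k : Type v) [Field k] (P : SetOperad.{u}) {A B : Type} [Finite A]
    [Finite B] (a : A) (p : P.obj A) (q : P.obj B) (c d : k) :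
    linComp k P a (Finsupp.single p c) (Finsupp.single q d) =
      Finsupp.single (P.comp a p q) (c * d) := by
  simp [linComp, Finsupp.mapDomain_single]

/-- The linearization `k.P` of a set operad `P`. -/
noncomputable def SetOperad.linearize (k : Type v) [Field k] (P : SetOperad.{u}) :
    LinOperad.{v, max u v} k where
  obj A _ := P.obj A →₀ k
  relabel e := Finsupp.lmapDomain k k (P.relabel e)
  one := Finsupp.single P.one 1
  comp a := linComp k P a
  positive A _ _ := by
    have := P.positive A
    infer_instance
  relabel_refl p := by
    induction p using Finsupp.induction_linear with
    | zero => simp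
    | add f g hf hg => rw [map_add, hf, hg]
    | single p c => simp [Finsupp.mapDomain_single, P.relabel_refl]
  relabel_trans e f p := by
    induction p using Finsupp.induction_linear with
    | zero => simp
    | add p q hp hq => simp only [map_add, hp, hq]
    | single p c => simp [Finsupp.mapDomain_single, P.relabel_trans]
  comp_relabel e f a p q := by
    induction p using Finsupp.induction_linear with
    | zero => simp
    | add p p' hp hp' => simp only [map_add, LinearMap.add_apply, hp, hp']
    | single p c =>
      induction q using Finsupp.induction_linear with
      | zero => simp
      | add q q' hq hq' => simp only [map_add, hq, hq']
      | single q d =>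
        simp [-Finsupp.single_mul, Finsupp.mapDomain_single, linComp_single, P.comp_relabel]
  comp_seq a b p q r := by
    induction p using Finsupp.induction_linear with
    | zero => simp
    | add p p' hp hp' => simp only [map_add, LinearMap.add_apply, hp, hp']
    | single p c =>
      induction q using Finsupp.induction_linear with
      | zero => simp
      | add q q' hq hq' => simp only [map_add, LinearMap.add_apply, hq, hq']
      | single q d =>
        induction r using Finsupp.induction_linear with
        | zero => simp
        | add r r' hr hr' => simp only [map_add, hr, hr']
        | single r d' =>
          simp [-Finsupp.single_mul, Finsupp.mapDomain_single, linComp_single, P.comp_seq, mul_assoc]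
  comp_par h p q r := by
    induction p using Finsupp.induction_linear with
    | zero => simp
    | add p p' hp hp' => simp only [map_add, LinearMap.add_apply, hp, hp']
    | single p c =>
      induction q using Finsupp.induction_linear with
      | zero => simp
      | add q q' hq hq' => simp only [map_add, LinearMap.add_apply, hq, hq']
      | single q d =>
        induction r using Finsupp.induction_linear with
        | zero => simp
        | add r r' hr hr' => simp only [map_add, LinearMap.add_apply, hr, hr']
        | single r d' =>
          simp [-Finsupp.single_mul, Finsupp.mapDomain_single, linComp_single, P.comp_par h, mul_right_comm]
  comp_one a p := by
    induction p using Finsupp.induction_linear with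
    | zero => simp
    | add p p' hp hp' => simp only [map_add, LinearMap.add_apply, hp, hp']
    | single p c => simp [-Finsupp.single_mul, Finsupp.mapDomain_single, linComp_single, P.comp_one]
  one_comp q := by
    induction q using Finsupp.induction_linear with
    | zero => simp
    | add q q' hq hq' => simp only [map_add, hq, hq']
    | single q c => simp [-Finsupp.single_mul, Finsupp.mapDomain_single, linComp_single, P.one_comp]

/-! ### Family operads -/

/-- A set-theoretical Perm algebra: a set with a binary operation satisfying
`α(βγ) = (αβ)γ = β(αγ) = (βα)γ`. -/
def IsPermAlgebra {Ω : Type u} (op : Ω → Ω → Ω) : Prop :=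
  ∀ α β γ : Ω, op α (op β γ) = op (op α β) γ ∧ op (op α β) γ = op β (op α γ) ∧
    op β (op α γ) = op (op β α) γ

section Family

variable (k : Type v) [Field k] {Ω : Type u} (op : Ω → Ω → Ω)

/-- The free linear operad on binary operations `▷_{α,β}` indexed by `Ω × Ω`. -/
noncomputable abbrev famMag (Ω : Type u) : LinOperad.{v, max u v} k :=
  (freeOperad (Ω × Ω)).linearize k

/-- `x ▷_{α,βγ} (y ▷_{β,γ} z)`, where `x, y, z` are the three variables in some order. -/
noncomputable def famRight (α β γ : Ω) (x y z : Fin 3)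
    (H : [x, y, z].Nodup ∧ ∀ a, a ∈ [x, y, z] := by decide) : (famMag k Ω).obj (Fin 3) :=
  Finsupp.single (rightTree (α, op β γ) (β, γ) x y z H) (1 : k)

/-- `(x ▷_{α,β} y) ▷_{αβ,γ} z`, where `x, y, z` are the three variables in some order. -/
noncomputable def famLeft (α β γ : Ω) (x y z : Fin 3)
    (H : [x, y, z].Nodup ∧ ∀ a, a ∈ [x, y, z] := by decide) : (famMag k Ω).obj (Fin 3) :=
  Finsupp.single (leftTree (α, β) (op α β, γ) x y z H) (1 : k)

/-- Family associativity `x ▷_{α,βγ} (y ▷_{β,γ} z) = (x ▷_{α,β} y) ▷_{αβ,γ} z`. -/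
def asFamRel : Set ((famMag k Ω).obj (Fin 3)) :=
  {r | ∃ α β γ : Ω, r = famRight k op α β γ 0 1 2 - famLeft k op α β γ 0 1 2}

/-- Family twist-associativity `x ▷_{α,βγ} (y ▷_{β,γ} z) = - (y ▷_{β,α} x) ▷_{βα,γ} z`. -/
def tasFamRel : Set ((famMag k Ω).obj (Fin 3)) :=
  {r | ∃ α β γ : Ω, r = famRight k op α β γ 0 1 2 + famLeft k op β α γ 1 0 2}

/-- The family NAP and NAP' relations
`x ▷_{α,βγ} (y ▷_{β,γ} z) = y ▷_{β,αγ} (x ▷_{α,γ} z)` and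
`(x ▷_{α,β} y) ▷_{αβ,γ} z = (y ▷_{β,α} x) ▷_{βα,γ} z`. -/
def napnapFamRel : Set ((famMag k Ω).obj (Fin 3)) :=
  {r | (∃ α β γ : Ω, r = famRight k op α β γ 0 1 2 - famRight k op β α γ 1 0 2) ∨
    ∃ α β γ : Ω, r = famLeft k op α β γ 0 1 2 - famLeft k op β α γ 1 0 2}

/-- The family pre-Lie relation
`x ▷_{α,βγ} (y ▷_{β,γ} z) - (x ▷_{α,β} y) ▷_{αβ,γ} z =
y ▷_{β,αγ} (x ▷_{α,γ} z) - (y ▷_{β,α} x) ▷_{βα,γ} z`. -/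
def preLieFamRel : Set ((famMag k Ω).obj (Fin 3)) :=
  {r | ∃ α β γ : Ω, r = (famRight k op α β γ 0 1 2 - famLeft k op α β γ 0 1 2) -
    (famRight k op β α γ 1 0 2 - famLeft k op β α γ 1 0 2)}

/-- The operad presented by the operations `▷_{α,β}` and the ternary relations `R`. -/
noncomputable def famOperad (R : Set ((famMag k Ω).obj (Fin 3))) : LinOperad.{v, max u v} k :=
  (famMag k Ω).quotient R

/-- The class of the generator `▷_{α,β}`. -/
noncomputable def famGen (R : Set ((famMag k Ω).obj (Fin 3))) (α β : Ω) :
    (famOperad k R).obj (Fin 2) :=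
  (famMag k Ω).quotientMk R (Finsupp.single (gen (α, β)) (1 : k))

end Family

end SpeciesOperad

namespace SpeciesOperad

universe u v w

/-! ### Rightmost leaves -/

namespace Tree

variable {G : Type u} {A B : Type}

/-! Both halves reduce to checking generating relations.

For the set operads, sending a tree to its rightmost leaf is a morphism from the free operad to
`Perm`. Grafting on the leaf `a` changes the rightmost leaf only if that leaf is `a`, and then
replaces it by the rightmost leaf of the grafted tree (`rightmost_bind`); this is the composition
rule of `Perm`. Every tree in the relations of `As`, `TAs` and `NAPNAP` ends in `z`, so the morphism
descends to the three quotients. It is surjective because any element can be the last leaf of a comb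
(`exists_multilinear_rightmost_eq`).

For the linear operads, all four are quotients of the same free operad. It therefore suffices to
place the pre-Lie relators in each of the other three ideals (`MemIdeal.mono`, `quotientHom`).
Writing R, L for the right and left trees and R', L' for the same trees with `(x, α)` and `(y, β)`
exchanged, the pre-Lie relator R - L - R' + L' equals (R - L) - (R' - L'), (R + L') - (R' + L) and
(R - R') - (L - L'). These are differences of relators of `As`, `TAs` and `NAPNAP'` type
respectively, up to relabeling. -/

/-- The decoration of the rightmost leaf. -/
def rightmost : Tree G A → A
  | leaf a => a
  | node _ _ r => r.rightmost

theorem rightmost_bind (t : Tree G A) (f : A → Tree G B) :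
    (t.bind f).rightmost = (f t.rightmost).rightmost := by
  induction t with
  | leaf a => rfl
  | node g l r _ hr => exact hr

theorem rightmost_map (t : Tree G A) (f : A → B) : (t.map f).rightmost = f t.rightmost :=
  rightmost_bind t _

/-- The right comb with leaves `l` followed by `a`. -/
def comb (g : G) (a : A) : List A → Tree G A
  | [] => leaf a
  | x :: l => node g (leaf x) (comb g a l)

theorem leaves_comb (g : G) (a : A) (l : List A) : (comb g a l).leaves = l ++ [a] := by
  induction l with
  | nil => rfl
  | cons x l h => simp [comb, leaves, h]

theorem rightmost_comb (g : G) (a : A) (l : List A) : (comb g a l).rightmost = a := by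
  induction l with
  | nil => rfl
  | cons x l h => exact h

/-- This gives surjectivity onto `Perm`. The witness is a right comb: its leaves before `a`
enumerate the complement of `a` in arbitrary order, so each element occurs exactly once. -/
theorem exists_multilinear_rightmost_eq [Finite A] (g : G) (a : A) :
    ∃ t : Tree G A, t.Multilinear ∧ t.rightmost = a := by
  classical
  have := Fintype.ofFinite A
  refine ⟨comb g a (Finset.univ.erase a).toList, ⟨?_, fun x => ?_⟩, rightmost_comb g a _⟩
  · rw [leaves_comb, List.nodup_append]
    refine ⟨Finset.nodup_toList _, List.nodup_singleton a, fun x hx y hy => ?_⟩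
    rw [List.mem_singleton.1 hy]
    exact Finset.ne_of_mem_erase (Finset.mem_toList.1 hx)
  · by_cases h : x = a <;> simp [leaves_comb, h]

end Tree

/-! ### Morphisms out of quotients of set operads -/

namespace SetOperad

/-- The morphism induced on the quotient by a morphism that identifies related operations. -/
def Hom.descend {P : SetOperad.{u}} {Q : SetOperad.{v}} (f : Hom P Q) {X : Type} [Finite X]
    {R : P.obj X → P.obj X → Prop} (hR : ∀ p q, R p q → f.app p = f.app q) :
    Hom (P.quotient R) Q where
  app {A} _ := Quotient.lift f.app fun p q (h : Cong P R A p q) => by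
    -- Having equal images under `f` is an operadic congruence, so it contains the one generated by
    -- `R`.
    induction h with
    | of h => exact hR _ _ h
    | refl p => rfl
    | symm _ ih => exact ih.symm
    | trans _ _ ih ih' => exact ih.trans ih'
    | relabel e _ ih => rw [f.app_relabel, f.app_relabel, ih]
    | comp a _ _ ih ih' => rw [f.app_comp, f.app_comp, ih, ih']
  app_relabel := by
    rintro A B _ _ e ⟨p⟩
    exact f.app_relabel e p
  app_one := f.app_one
  app_comp := by
    rintro A B _ _ a ⟨p⟩ ⟨q⟩
    exact f.app_comp a p q

theorem Hom.Surjective.descend {P : SetOperad.{u}} {Q : SetOperad.{v}} {f : Hom P Q}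
    (hf : f.Surjective) {X : Type} [Finite X] {R : P.obj X → P.obj X → Prop}
    (hR : ∀ p q, R p q → f.app p = f.app q) : (f.descend hR).Surjective := fun A _ x =>
  let ⟨p, hp⟩ := hf A x
  ⟨P.quotientMk R p, hp⟩

end SetOperad

/-- The morphism from a free operad on binary generators to `Perm` that sends every generator to
the binary generator: it maps a tree to its rightmost leaf. -/
noncomputable def rightmostHom (G : Type u) : SetOperad.Hom (freeOperad G) Perm where
  app p := p.1.rightmost
  app_relabel e p := Tree.rightmost_map p.1 e
  app_one := rfl
  app_comp a p q := by
    refine (Tree.rightmost_bind p.1 _).trans ?_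
    -- These are the two branches of the composition in `Perm`: the rightmost leaf is either the one
    -- grafted upon or survives unchanged.
    by_cases h : p.1.rightmost = a
    · simp [h, Tree.graftAt_self, Tree.rightmost_map, Perm]
    · simp [h, Tree.graftAt_ne, Tree.rightmost, Perm]

theorem rightmostHom_surjective (G : Type u) [Nonempty G] : (rightmostHom G).Surjective :=
  fun A _ a =>
    let ⟨t, ht, h⟩ := Tree.exists_multilinear_rightmost_eq (A := A) (Classical.arbitrary G) a
    ⟨⟨t, ht⟩, h⟩

/-! ### Morphisms between quotients of linear operads -/

namespace LinOperad

variable {k : Type v} [Field k]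

/-- The ideal generated by `S` has all the closure properties defining the one generated by `R`, so
only the generators need checking. -/
theorem MemIdeal.mono {P : LinOperad.{v, w} k} {X : Type} [Finite X] {R S : Set (P.obj X)}
    (hR : ∀ p ∈ R, MemIdeal P S X p) {A : Type} [Finite A] {p : P.obj A}
    (h : MemIdeal P R A p) : MemIdeal P S A p := by
  induction h with
  | of h => exact hR _ h
  | zero => exact .zero
  | add _ _ h h' => exact .add h h'
  | smul c _ h => exact .smul c h
  | relabel e _ h => exact .relabel e h
  | comp_left a q _ h => exact .comp_left a q h
  | comp_right a p _ h => exact .comp_right a p h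

theorem MemIdeal.sub {P : LinOperad.{v, w} k} {X : Type} [Finite X] {R : Set (P.obj X)}
    {A : Type} [Finite A] {p q : P.obj A} (hp : MemIdeal P R A p) (hq : MemIdeal P R A q) :
    MemIdeal P R A (p - q) :=
  (P.ideal R A).sub_mem hp hq

/-- The projection between the quotients by two operadic ideals, one contained in the other. -/
def quotientHom (P : LinOperad.{v, w} k) {X : Type} [Finite X] {R S : Set (P.obj X)}
    (hR : ∀ p ∈ R, MemIdeal P S X p) : Hom (P.quotient R) (P.quotient S) where
  app {A} _ := (P.ideal R A).mapQ (P.ideal S A) LinearMap.id fun _ h => MemIdeal.mono hR h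
  app_relabel := by
    -- On representatives the map is the identity, and both quotients inherit their structure from
    -- `P`, so compatibility is definitional.
    rintro A B _ _ e ⟨p⟩
    rfl
  app_one := rfl
  app_comp := by
    rintro A B _ _ a ⟨p⟩ ⟨q⟩
    rfl

theorem quotientHom_surjective (P : LinOperad.{v, w} k) {X : Type} [Finite X]
    {R S : Set (P.obj X)} (hR : ∀ p ∈ R, MemIdeal P S X p) : (P.quotientHom hR).Surjective := by
  rintro A _ ⟨p⟩
  exact ⟨P.quotientMk R p, rfl⟩

end LinOperad

/-! ### The family pre-Lie relation in the other family operads -/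

section Family

variable (k : Type v) [Field k] {Ω : Type u} (op : Ω → Ω → Ω)

/-- The relators are listed for one order of the variables only; relabeling supplies the copy with
`x` and `y` exchanged. It moves leaves but not decorations, so exchanging `α` and `β` is done
separately, by instantiating the relator at `(β, α, γ)`. -/
theorem relabel_famRight (α β γ : Ω) :
    (famMag k Ω).relabel (Equiv.swap 0 1) (famRight k op α β γ 0 1 2) =
      famRight k op α β γ 1 0 2 :=
  Finsupp.mapDomain_single

theorem relabel_famLeft (α β γ : Ω) :
    (famMag k Ω).relabel (Equiv.swap 0 1) (famLeft k op α β γ 0 1 2) =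
      famLeft k op α β γ 1 0 2 :=
  Finsupp.mapDomain_single

/-- Needed for `tasFamRel`, whose left tree already has its first two leaves exchanged. -/
theorem relabel_famLeft_swap (α β γ : Ω) :
    (famMag k Ω).relabel (Equiv.swap 0 1) (famLeft k op α β γ 1 0 2) =
      famLeft k op α β γ 0 1 2 :=
  Finsupp.mapDomain_single

theorem memIdeal_asFamRel_of_mem_preLieFamRel :
    ∀ p ∈ preLieFamRel k op, (famMag k Ω).MemIdeal (asFamRel k op) (Fin 3) p := by
  rintro _ ⟨α, β, γ, rfl⟩
  refine .sub (.of ⟨α, β, γ, rfl⟩) ?_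
  -- The subtracted half is the transposition applied to the associativity relator at `(β, α, γ)`.
  rw [← relabel_famRight, ← relabel_famLeft, ← map_sub]
  exact .relabel _ (.of ⟨β, α, γ, rfl⟩)

/-- Each right tree is paired with the left tree of the opposite order. In the pre-Lie relator these
two carry equal signs, which is why twist-associativity has a minus sign. -/
theorem memIdeal_tasFamRel_of_mem_preLieFamRel :
    ∀ p ∈ preLieFamRel k op, (famMag k Ω).MemIdeal (tasFamRel k op) (Fin 3) p := by
  rintro _ ⟨α, β, γ, rfl⟩
  have h : (famMag k Ω).MemIdeal (tasFamRel k op) (Fin 3)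
      (famRight k op β α γ 1 0 2 + famLeft k op α β γ 0 1 2) := by
    rw [← relabel_famRight, ← relabel_famLeft_swap, ← map_add]
    exact .relabel _ (.of ⟨β, α, γ, rfl⟩)
  have h' : (famMag k Ω).MemIdeal (tasFamRel k op) (Fin 3)
      (famRight k op α β γ 0 1 2 + famLeft k op β α γ 1 0 2) := .of ⟨α, β, γ, rfl⟩
  convert h'.sub h using 1
  abel

theorem memIdeal_napnapFamRel_of_mem_preLieFamRel :
    ∀ p ∈ preLieFamRel k op, (famMag k Ω).MemIdeal (napnapFamRel k op) (Fin 3) p := by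
  rintro _ ⟨α, β, γ, rfl⟩
  -- Regroups right trees with right trees and left with left, giving a NAP relator minus a NAP'
  -- relator. Both orders already occur in each, so no relabeling is needed.
  rw [sub_sub_sub_comm]
  exact .sub (.of (.inl ⟨α, β, γ, rfl⟩)) (.of (.inr ⟨α, β, γ, rfl⟩))

end Family

end SpeciesOperad

theorem mainTheorem12 :
    ((∃ f : SpeciesOperad.SetOperad.Hom SpeciesOperad.As SpeciesOperad.Perm,
        f.app SpeciesOperad.As.mu = SpeciesOperad.Perm.mu ∧ f.Surjective) ∧
      (∃ f : SpeciesOperad.SetOperad.Hom SpeciesOperad.TAs SpeciesOperad.Perm,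
        f.app SpeciesOperad.TAs.mu = SpeciesOperad.Perm.mu ∧ f.Surjective) ∧
      (∃ f : SpeciesOperad.SetOperad.Hom SpeciesOperad.NAPNAP SpeciesOperad.Perm,
        f.app SpeciesOperad.NAPNAP.mu = SpeciesOperad.Perm.mu ∧ f.Surjective)) ∧
    ∀ (k : Type*) [Field k] (Ω : Type*) (op : Ω → Ω → Ω), SpeciesOperad.IsPermAlgebra op →
      (∃ f : SpeciesOperad.LinOperad.Hom
          (SpeciesOperad.famOperad k (SpeciesOperad.preLieFamRel k op))
          (SpeciesOperad.famOperad k (SpeciesOperad.asFamRel k op)),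
        (∀ α β : Ω, f.app (SpeciesOperad.famGen k (SpeciesOperad.preLieFamRel k op) α β) =
          SpeciesOperad.famGen k (SpeciesOperad.asFamRel k op) α β) ∧ f.Surjective) ∧
      (∃ f : SpeciesOperad.LinOperad.Hom
          (SpeciesOperad.famOperad k (SpeciesOperad.preLieFamRel k op))
          (SpeciesOperad.famOperad k (SpeciesOperad.tasFamRel k op)),
        (∀ α β : Ω, f.app (SpeciesOperad.famGen k (SpeciesOperad.preLieFamRel k op) α β) =
          SpeciesOperad.famGen k (SpeciesOperad.tasFamRel k op) α β) ∧ f.Surjective) ∧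
      (∃ f : SpeciesOperad.LinOperad.Hom
          (SpeciesOperad.famOperad k (SpeciesOperad.preLieFamRel k op))
          (SpeciesOperad.famOperad k (SpeciesOperad.napnapFamRel k op)),
        (∀ α β : Ω, f.app (SpeciesOperad.famGen k (SpeciesOperad.preLieFamRel k op) α β) =
          SpeciesOperad.famGen k (SpeciesOperad.napnapFamRel k op) α β) ∧ f.Surjective) := by
  refine ⟨⟨?_, ?_, ?_⟩, fun k _ Ω op _ => ⟨?_, ?_, ?_⟩⟩
  -- Both sides of the relation have rightmost leaf `2`; the second `rfl` says that the rightmost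
  -- leaf of the generator is `1`, which is `Perm.mu`.
  · exact ⟨(SpeciesOperad.rightmostHom Unit).descend fun _ _ h => by cases h; rfl, rfl,
      (SpeciesOperad.rightmostHom_surjective Unit).descend _⟩
  · exact ⟨(SpeciesOperad.rightmostHom Unit).descend fun _ _ h => by cases h; rfl, rfl,
      (SpeciesOperad.rightmostHom_surjective Unit).descend _⟩
  · exact ⟨(SpeciesOperad.rightmostHom Unit).descend fun _ _ h => by cases h <;> rfl, rfl,
      (SpeciesOperad.rightmostHom_surjective Unit).descend _⟩
  · exact ⟨SpeciesOperad.LinOperad.quotientHom _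
      (SpeciesOperad.memIdeal_asFamRel_of_mem_preLieFamRel k op), fun _ _ => rfl,
      SpeciesOperad.LinOperad.quotientHom_surjective _ _⟩
  · exact ⟨SpeciesOperad.LinOperad.quotientHom _
      (SpeciesOperad.memIdeal_tasFamRel_of_mem_preLieFamRel k op), fun _ _ => rfl,
      SpeciesOperad.LinOperad.quotientHom_surjective _ _⟩
  · exact ⟨SpeciesOperad.LinOperad.quotientHom _
      (SpeciesOperad.memIdeal_napnapFamRel_of_mem_preLieFamRel k op), fun _ _ => rfl,
      SpeciesOperad.LinOperad.quotientHom_surjective _ _⟩
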